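/- Let $n\ge 1$. Let $R^0=\mathbb{Q}[b_{ij}]_{1\le i,j\le n}$, let $B=(b_{ij})$ be the generic $n\times n$ matrix, let $R$ be the exterior algebra over $R^0$ of the free $R^0$-module with basis $\omega_{ij}$ $(1\le i,j\le n)$, and let $\Omega=(\omega_{ij})$ be the generic $n\times n$ matrix of one-forms. A type of rank $n$ is a subset $\nu\subset\{1,\dots,n\}^2$ with $2n-1$ elements. For a type $\nu$ let $\Omega_\nu$ be the matrix with entry $\omega_{ij}$ in position $(i,j)$ if $(i,j)\in\nu$ and $0$ otherwise, and put $$\underline p(\nu)_i=|\{j:(i,j)\in\nu\}|,\qquad \underline q(\nu)_j=|\{i:(i,j)\in\nu\}|.$$ *The form $\omega_\nu$.* Choose an ordering $\nu=((i_1,j_1),\dots,(i_{2n-1},j_{2n-1}))$. Let $M_\nu$ be the $(2n-1)\times 2n$ matrix whose $l$-th row has $-1$ in column $i_l$, $1$ in column $n+j_l$, and $0$ elsewhere. Choose $k\in\{1,\dots,2n\}$, let $M_\nu^{\emptyset,k}$ be $M_\nu$ with the $k$-th column deleted, and let $$\omega_\nu=(-1)^{\binom n2+k-1}\det(M_\nu^{\emptyset,k})\;\omega_{i_1j_1}\wedge\cdots\wedge\omega_{i_{2n-1}j_{2n-1}}.$$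 *The matrix $\Phi_\nu(B)$.* For $\underline p,\underline q\in\mathbb{Z}^n$ with equal sum of components, let $P_{\underline p,\underline q}(B)=0$ if some component of $\underline p$ or $\underline q$ is negative; otherwise let $P_{\underline p,\underline q}(B)$ be the permanent of the matrix obtained from $B$ by taking $p_i$ copies of row $i$ and $q_j$ copies of column $j$ for all $i,j$ (the empty permanent is $1$). With the standard basis vectors $\underline e_i$ and $\underline 1=(1,\dots,1)$, let $\Phi_\nu(B)$ be the $n\times n$ matrix with entries $$\Phi_\nu(B)_{ij}=(\underline q(\nu)_j+\delta_{ij}-1)\,P_{\underline q(\nu)+\underline e_i-\underline e_j-\underline 1,\;\underline p(\nu)-\underline 1}(B).$$ Then, for every type $\nu$ of rank $n$ and all choices of the ordering of $\nu$ and of $k$, $$(B\Omega_\nu)^{2n-1}=\det(B)\,\Phi_\nu(B)\,\omega_\nu .$$ Moreover, the sums being over all types $\nu$ of rank $n$, $$(B\Omega)^{2n-1}=\sum_\nu (B\Omega_\nu)^{2n-1}=\det(B)\sum_\nu\Phi_\nu(B)\,\omega_\nu .$$ More generally, let $A$ be a commutative $\mathbb{Q}$-algebra, $S$ an associative unital $A$-algebra,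 $B$ an $n\times n$ matrix with entries in $A$, and $\Omega$ an $n\times n$ matrix with entries in $S$ that satisfy $\Omega_{ij}\Omega_{kl}=-\Omega_{kl}\Omega_{ij}$ for all $i,j,k,l$ (for instance, matrices of $0$-forms and of $1$-forms). Define $\Phi_\nu(B)$ as above, and $\omega_\nu$ as above with the entries $\Omega_{ij}$ in place of $\omega_{ij}$. Then $$(B\Omega)^{2n-1}=\det(B)\sum_\nu\Phi_\nu(B)\,\omega_\nu .$$ -/

import Mathlib

namespace BOmega

/-- A type of rank `n`: a set of `2n - 1` positions in an `n × n` matrix. -/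
abbrev MType (n : ℕ) : Type :=
  {ν : Finset (Fin n × Fin n) // ν.card = 2 * n - 1}

/-- An ordering `(i₁,j₁), …, (i_{2n-1}, j_{2n-1})` of the elements of a type. -/
abbrev MType.Ordering {n : ℕ} (ν : MType n) : Type :=
  Fin (2 * n - 1) ≃ {x : Fin n × Fin n // x ∈ ν.1}

/-- `p(ν)_i`: the number of positions of `ν` in row `i`. -/
def rowWeight {n : ℕ} (ν : MType n) (i : Fin n) : ℤ :=
  ((ν.1.filter fun x => x.1 = i).card : ℤ)

/-- `q(ν)_j`: the number of positions of `ν` in column `j`. -/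
def colWeight {n : ℕ} (ν : MType n) (j : Fin n) : ℤ :=
  ((ν.1.filter fun x => x.2 = j).card : ℤ)

/-- The `(2n-1) × 2n` matrix `M_ν`. Its row indexed by `(i,j) ∈ ν` has a `-1` in the column of `i`,
a `1` in the column of `n + j`, and zeros elsewhere. Everything is numbered from `0`, and `2n`
is written as `2n - 1 + 1` (they agree for `n ≥ 1`). -/
def incidence {n : ℕ} {ν : MType n} (e : ν.Ordering) :
    Matrix (Fin (2 * n - 1)) (Fin (2 * n - 1 + 1)) ℤ :=
  Matrix.of fun l c =>
    if (c : ℕ) = ((e l).1.1 : ℕ) then -1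
    else if (c : ℕ) = n + ((e l).1.2 : ℕ) then 1
    else 0

/-- The minor of `M_ν` obtained by deleting column `k`. -/
def incidenceMinor {n : ℕ} {ν : MType n} (e : ν.Ordering) (k : Fin (2 * n - 1 + 1)) : ℤ :=
  ((incidence e).submatrix id k.succAbove).det

/-- The product `η_ν = Ω_{i₁j₁} ∧ ⋯ ∧ Ω_{i_{2n-1}j_{2n-1}}`, in the chosen order. -/
def eta {n : ℕ} {S : Type*} [Ring S] (Ω : Matrix (Fin n) (Fin n) S) {ν : MType n}
    (e : ν.Ordering) : S :=
  (List.ofFn fun l => Ω (e l).1.1 (e l).1.2).prod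

/-- The form `ω_ν = (-1)^{binom(n,2) + k - 1} det(M_ν^{∅,k}) η_ν`, computed with the ordering `e` and
the deleted column `k`; as `k` is numbered from `0` here, the exponent is `binom(n,2) + k`. -/
def omegaForm {n : ℕ} {S : Type*} [Ring S] (Ω : Matrix (Fin n) (Fin n) S) {ν : MType n}
    (e : ν.Ordering) (k : Fin (2 * n - 1 + 1)) : S :=
  ((-1 : ℤ) ^ (n.choose 2 + (k : ℕ)) * incidenceMinor e k) • eta Ω e

/-- `Ω_ν`: the matrix with the entries of `Ω` in the positions of `ν`, and zeros elsewhere. -/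
def restrict {n : ℕ} {S : Type*} [Zero S] (Ω : Matrix (Fin n) (Fin n) S) (ν : MType n) :
    Matrix (Fin n) (Fin n) S :=
  Matrix.of fun i j => if (i, j) ∈ ν.1 then Ω i j else 0

/-- The permanent of a matrix whose rows and columns are indexed by two finite types, as the sum over
all bijections from rows to columns. -/
def perm {r c : Type*} [Fintype r] [Fintype c] [DecidableEq r] [DecidableEq c]
    {A : Type*} [CommSemiring A] (M : Matrix r c A) : A :=
  ∑ σ : r ≃ c, ∏ i, M i (σ i)

/-- When rows and columns have the same index type, `perm` is Mathlib's permanent. -/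
theorem perm_eq_permanent {r : Type*} [Fintype r] [DecidableEq r] {A : Type*} [CommSemiring A]
    (M : Matrix r r A) : perm M = M.permanent := by
  unfold perm Matrix.permanent
  refine Fintype.sum_equiv (Equiv.inv (Equiv.Perm r)) _ _ fun σ => ?_
  refine Fintype.prod_equiv σ _ _ fun i => ?_
  simp

/-- The multiset `{1^{p_1}, …, n^{p_n}}`, as an index type: `p_i` copies of each `i`. -/
abbrev Copies {n : ℕ} (p : Fin n → ℤ) : Type :=
  Σ i : Fin n, Fin (p i).toNat

/-- The permanent polynomial `P_{p,q}(B) = perm(B_{S_p,S_q})` for integer vectors `p`, `q` of equal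
sum; it is zero if some component of `p` or of `q` is negative. -/
def permPoly {n : ℕ} {A : Type*} [CommRing A] (p q : Fin n → ℤ) (B : Matrix (Fin n) (Fin n) A) : A :=
  if (∀ i, 0 ≤ p i) ∧ (∀ i, 0 ≤ q i) then
    perm (Matrix.of fun (a : Copies p) (b : Copies q) => B a.1 b.1)
  else 0

/-- The matrix of permanents
`Φ_ν(B)_{ij} = (q(ν)_j + δ_{ij} - 1) P_{q(ν) + e_i - e_j - 1, p(ν) - 1}(B)`. -/
def Phi {n : ℕ} {A : Type*} [CommRing A] (ν : MType n) (B : Matrix (Fin n) (Fin n) A) :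
    Matrix (Fin n) (Fin n) A :=
  Matrix.of fun i j =>
    (colWeight ν j + (if i = j then 1 else 0) - 1) •
      permPoly (colWeight ν + Pi.single i 1 - Pi.single j 1 - 1) (rowWeight ν - 1) B

/-- `R⁰ = ℚ[b_{ij}]`. -/
abbrev R0 (n : ℕ) : Type :=
  MvPolynomial (Fin n × Fin n) ℚ

/-- The algebra `R`: the exterior algebra over `R⁰` on the free module with basis `ω_{ij}`. -/
abbrev R (n : ℕ) : Type :=
  ExteriorAlgebra (R0 n) (Fin n × Fin n → R0 n)

/-- The generic matrix `B = (b_{ij})`. -/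
noncomputable def genB (n : ℕ) : Matrix (Fin n) (Fin n) (R0 n) :=
  Matrix.of fun i j => MvPolynomial.X (i, j)

/-- The generic matrix of one-forms `Ω = (ω_{ij})`. -/
noncomputable def genOmega (n : ℕ) : Matrix (Fin n) (Fin n) (R n) :=
  Matrix.of fun i j => ExteriorAlgebra.ι (R0 n) (Pi.single (i, j) 1)

/-- `(BΩ)^{2n-1}`, for `B` with entries in `A` and `Ω` with entries in an `A`-algebra `S`. -/
def XPow {n : ℕ} {A S : Type*} [CommRing A] [Ring S] [Algebra A S]
    (B : Matrix (Fin n) (Fin n) A) (Ω : Matrix (Fin n) (Fin n) S) : Matrix (Fin n) (Fin n) S :=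
  (B.map (algebraMap A S) * Ω) ^ (2 * n - 1)

end BOmega

/-! Any anticommuting `Ω` is the image of a matrix of one-forms in an exterior algebra, so work
there. The entries of `Y = (BΩ)²` are central, and graded cyclicity gives `tr (Y ^ (k + 1)) = -tr (Y
^ (k + 1)) = 0`. Over a commutative `ℚ`-algebra this forces the characteristic polynomial of `Y` to
be `X ^ n`, whence `Y ^ (n - 1) = (-1) ^ (n - 1) adj Y`. With `Z = ΩBΩ` one has `Y = BZ` and `adj Y
= adj Z * adj B`, so `(BΩ) ^ (2n - 1) = Y ^ (n - 1) BΩ = (-1) ^ (n - 1) det B • (adj Z * Ω)`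
(`mul_oneForms_pow`).

It remains to expand two expressions in the same products of one-forms. In `adj Z * Ω` the signs of
the minors cancel against those from reordering one-forms, leaving permanents (`adjugate_mul_ι`). In
row `i` of `∑ Φ_ν ω_ν`, delete from each `M_ν` the column belonging to column `i` of `Ω`. The
nonzero terms of the minors are then the sequences with one position in each row, followed by one in
each column other than `i` (`sum_Phi_smul_omegaForm`). The formula for one type is the general
formula applied to `Ω_ν`. -/

/-! ### Vanishing traces, characteristic polynomial and adjugate over a commutative ring. -/

open Polynomial in
/-- Jacobi's formula for the derivative of the determinant of a polynomial matrix. -/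
theorem Matrix.derivative_det_eq_trace {ι K : Type*} [Fintype ι] [DecidableEq ι] [CommRing K]
    (M : Matrix ι ι K[X]) :
    derivative M.det = (M.adjugate * M.map derivative).trace := by
  have h : ∀ i, ∑ j, M.adjugate i j * derivative (M j i) =
      ∑ σ : Equiv.Perm ι, Equiv.Perm.sign σ •
        (derivative (M (σ i) i) * ∏ j ∈ Finset.univ.erase i, M (σ j) j) := by
    intro i
    have h1 : ∑ j, M.adjugate i j * derivative (M j i) =
        (M.updateCol i fun j => derivative (M j i)).det := by
      rw [← Matrix.cramer_apply, Matrix.cramer_eq_adjugate_mulVec]; rfl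
    rw [h1, Matrix.det_apply]
    refine Finset.sum_congr rfl fun σ _ => ?_
    rw [← Finset.mul_prod_erase _ _ (Finset.mem_univ i)]
    congr 2
    · simp
    · refine Finset.prod_congr rfl fun j hj => ?_
      rw [Matrix.updateCol_ne (Finset.ne_of_mem_erase hj)]
  simp only [Matrix.trace, Matrix.diag, Matrix.mul_apply, Matrix.map_apply, h]
  rw [Finset.sum_comm, Matrix.det_apply, derivative_sum]
  refine Finset.sum_congr rfl fun σ _ => ?_
  rw [← Finset.smul_sum, Units.smul_def, Units.smul_def, derivative_smul, derivative_prod_finset]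
  congr 1
  exact Finset.sum_congr rfl fun i _ => by rw [mul_comm]

open Polynomial in
/-- If the traces of all positive powers of a matrix over a commutative `ℚ`-algebra vanish, then its
characteristic polynomial is a power of the variable. -/
theorem Matrix.charpoly_eq_X_pow_of_trace_pow_eq_zero {ι K : Type*} [Fintype ι] [DecidableEq ι]
    [CommRing K] [Algebra ℚ K] (Y : Matrix ι ι K) (hY : ∀ k, (Y ^ (k + 1)).trace = 0) :
    Y.charpoly = X ^ Fintype.card ι := by
  nontriviality K
  set T : Matrix ι ι K[X] := Y.map C with hT
  -- `det N` is the reversed characteristic polynomial. By Jacobi its derivative is `-tr (adj N *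
  -- T)`, which vanishes because it is divisible by every power of `X`.
  set N : Matrix ι ι K[X] := 1 - (X : K[X]) • T with hN
  have htr : ∀ k, (T ^ (k + 1)).trace = 0 := fun k => by
    have : T ^ (k + 1) = (Y ^ (k + 1)).map C := (Matrix.map_pow Y C (k + 1)).symm
    rw [this]
    exact (AddMonoidHom.map_trace (C : K →+* K[X]) (Y ^ (k + 1))).symm.trans (by rw [hY, map_zero])
  have hadj : ∀ k, N.adjugate * T ^ (k + 1) =
      N.det • T ^ (k + 1) + (X : K[X]) • (N.adjugate * T ^ (k + 2)) := fun k => by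
    have h1 : N.adjugate * N = N.det • 1 := N.adjugate_mul
    have h2 : N.adjugate * N * T ^ (k + 1) = N.adjugate * T ^ (k + 1) -
        (X : K[X]) • (N.adjugate * T ^ (k + 2)) := by
      rw [hN, mul_assoc, sub_mul, mul_sub, one_mul, smul_mul_assoc, mul_smul_comm, ← pow_succ']
    rw [h1, smul_mul_assoc, one_mul] at h2
    rw [h2, sub_add_cancel]
  have hdvd : ∀ k, (N.adjugate * T).trace = X ^ k * (N.adjugate * T ^ (k + 1)).trace := by
    intro k
    induction k with
    | zero => simp
    | succ k ih =>
      rw [ih, hadj k, Matrix.trace_add, Matrix.trace_smul, Matrix.trace_smul, htr, smul_zero,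
        zero_add, smul_eq_mul, ← mul_assoc, ← pow_succ]
  have hzero : (N.adjugate * T).trace = 0 := by
    ext d
    rw [hdvd (d + 1), coeff_X_pow_mul', if_neg (by omega), coeff_zero]
  have hder : derivative Y.charpolyRev = 0 := by
    have hmap : N.map derivative = -T := by
      ext i j : 2
      simp [hN, hT, Matrix.one_apply, apply_ite]
    have : Y.charpolyRev = N.det := rfl
    rw [this, Matrix.derivative_det_eq_trace, hmap, mul_neg, Matrix.trace_neg, hzero, neg_zero]
  have hrev : Y.charpolyRev = 1 := by
    -- The `ℚ`-algebra structure is needed here: a polynomial with zero derivative is constant.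
    have : IsAddTorsionFree K := IsAddTorsionFree.of_module_rat K
    have h := derivative_eq_zero.mp hder
    rw [eq_C_of_natDegree_eq_zero h, coeff_zero_eq_eval_zero, Matrix.eval_charpolyRev, map_one]
  have hr : Y.charpoly.reverse = 1 := by rw [Matrix.reverse_charpoly, hrev]
  have h2 := congrArg (reflect Y.charpoly.natDegree) hr
  rw [reverse, reflect_reflect, Matrix.charpoly_natDegree_eq_dim] at h2
  rw [h2, ← C_1, reflect_C, map_one, one_mul]

open Polynomial in
/-- A matrix with characteristic polynomial `X ^ (m + 1)` has `m`-th power `± adjugate`. -/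
theorem Matrix.pow_eq_adjugate_of_charpoly_eq_X_pow {m : ℕ} {K : Type*} [CommRing K]
    (Y : Matrix (Fin (m + 1)) (Fin (m + 1)) K) (hY : Y.charpoly = X ^ (m + 1)) :
    Y ^ m = (-1 : ℤ) ^ m • Y.adjugate := by
  set T : Matrix (Fin (m + 1)) (Fin (m + 1)) K[X] := Y.map C with hT
  set U : Matrix (Fin (m + 1)) (Fin (m + 1)) K[X] := (X : K[X]) • 1 with hU
  have hchar : Y.charmatrix = U - T := by
    rw [Matrix.charmatrix, hU, hT, Matrix.scalar_apply, ← Matrix.smul_one_eq_diagonal]; rfl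
  have hpow : Y ^ (m + 1) = 0 := by
    have := Matrix.aeval_self_charpoly Y
    rwa [hY, map_pow, aeval_X] at this
  have hTpow : T ^ (m + 1) = 0 := by
    have : T ^ (m + 1) = (Y ^ (m + 1)).map C := (Matrix.map_pow Y C (m + 1)).symm
    rw [this, hpow, Matrix.map_zero _ (map_zero _)]
  have hcomm : Commute U T := by
    rw [hU]; exact (Commute.one_left T).smul_left X
  have hgeom := hcomm.mul_geom_sum₂ (m + 1)
  have hUpow : ∀ k, U ^ k = (X ^ k : K[X]) • 1 := fun k => by rw [hU, _root_.smul_pow, one_pow]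
  rw [hTpow, sub_zero, hUpow] at hgeom
  -- Both sides have product `X ^ (m + 1) • 1` with `U - T`, and `X ^ (m + 1)` is monic, hence
  -- cancellable.
  have hadj : (U - T).adjugate = ∑ k ∈ Finset.range (m + 1), U ^ k * T ^ (m + 1 - 1 - k) := by
    have h1 := congrArg ((U - T).adjugate * ·) hgeom
    beta_reduce at h1
    rw [← mul_assoc, Matrix.adjugate_mul, ← hchar, ← Matrix.charpoly, hY, smul_mul_assoc, one_mul,
      mul_smul_comm, mul_one] at h1
    rw [← hchar]
    refine Matrix.ext fun i j => ?_
    have h2 := congrFun (congrFun h1 i) j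
    rw [Matrix.smul_apply, Matrix.smul_apply, smul_eq_mul, smul_eq_mul] at h2
    exact ((monic_X_pow (m + 1)).isRegular.left h2).symm
  -- At `X = 0` only the term `k = 0` survives, giving `adj (-Y) = Y ^ m`.
  have h3 := congrArg (fun M => (evalRingHom (0 : K)).mapMatrix M) hadj
  simp only [RingHom.map_adjugate, map_sum, map_mul, map_pow, map_sub] at h3
  have hU0 : (evalRingHom (0 : K)).mapMatrix U = 0 := by
    ext i j; simp [hU]
  have hT0 : (evalRingHom (0 : K)).mapMatrix T = Y := by
    ext i j; simp [hT]
  rw [hU0, hT0, zero_sub, Finset.sum_range_succ'] at h3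
  simp only [pow_succ, mul_zero, zero_mul, Finset.sum_const_zero, zero_add, pow_zero, one_mul,
    add_tsub_cancel_right, tsub_zero] at h3
  rw [← h3, ← neg_one_smul K Y, Matrix.adjugate_smul, Fintype.card_fin,
    add_tsub_cancel_right]
  rcases Nat.even_or_odd m with h' | h' <;>
    simp [h'.neg_one_pow]

/-! ### Odd powers of matrices of one-forms. -/

theorem ExteriorAlgebra.ι_mul_ι_mem_center {A V : Type*} [CommRing A] [AddCommGroup V] [Module A V]
    (v w : V) : ι A v * ι A w ∈ Subalgebra.center A (ExteriorAlgebra A V) := by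
  rw [Subalgebra.mem_center_iff]
  intro b
  induction b using ExteriorAlgebra.induction with
  | algebraMap r => exact Algebra.commutes r _
  | ι x =>
    have h1 : ∀ y z : V, ι A y * ι A z = -(ι A z * ι A y) := fun y z =>
      eq_neg_of_add_eq_zero_left (ι_add_mul_swap y z)
    rw [← mul_assoc, h1 x v, neg_mul, mul_assoc, h1 x w, mul_neg, neg_neg, mul_assoc]
  | mul a b ha hb => rw [mul_assoc, hb, ← mul_assoc, ha, mul_assoc]
  | add a b ha hb => rw [add_mul, ha, hb, mul_add]

/-- The traces of the even powers of a matrix of one-forms vanish. -/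
theorem ExteriorAlgebra.trace_pow_eq_zero {d A V : Type*} [Fintype d] [DecidableEq d] [CommRing A]
    [Algebra ℚ A] [AddCommGroup V] [Module A V] (v : d → d → V)
    (Y : Matrix d d (Subalgebra.center A (ExteriorAlgebra A V)))
    (hY : (Subalgebra.center A (ExteriorAlgebra A V)).val.mapMatrix Y =
      Matrix.of (fun i j => ι A (v i j)) * Matrix.of fun i j => ι A (v i j)) (k : ℕ) :
    (Y ^ (k + 1)).trace = 0 := by
  set φ := (Subalgebra.center A (ExteriorAlgebra A V)).val.mapMatrix (m := d) with hφ
  set X : Matrix d d (ExteriorAlgebra A V) := Matrix.of fun i j => ι A (v i j) with hX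
  have hanti : ∀ i j k l, X i j * X k l = -(X k l * X i j) := fun i j k l =>
    eq_neg_of_add_eq_zero_left (ι_add_mul_swap _ _)
  have hcomm : ∀ (c : ExteriorAlgebra A V) (a b : d), c * φ (Y ^ k) a b = φ (Y ^ k) a b * c :=
    fun c a b => Subalgebra.mem_center_iff.mp ((Y ^ k) a b).2 c
  have hXY : φ (Y ^ k) * X = X * φ (Y ^ k) := by
    rw [map_pow, hY]
    exact ((Commute.refl X).mul_left (Commute.refl X)).pow_left k
  have hpow : φ (Y ^ (k + 1)) = X * (X * φ (Y ^ k)) := by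
    rw [pow_succ', map_mul, hY, mul_assoc]
  have hodd : ∀ i j a b, X i j * (X * φ (Y ^ k)) a b = -((X * φ (Y ^ k)) a b * X i j) := by
    intro i j a b
    rw [Matrix.mul_apply, Finset.mul_sum, Finset.sum_mul, ← Finset.sum_neg_distrib]
    refine Finset.sum_congr rfl fun c _ => ?_
    rw [← mul_assoc, hanti, neg_mul, mul_assoc, hcomm (X i j), ← mul_assoc]
  -- Cyclicity of the trace acquires a sign, since the entries of both `X` and `X * φ (Y ^ k)` are
  -- odd.
  have hneg : (X * (X * φ (Y ^ k))).trace = -(X * (X * φ (Y ^ k))).trace := by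
    have hOX : X * φ (Y ^ k) * X = X * (X * φ (Y ^ k)) := by rw [mul_assoc, hXY]
    calc (X * (X * φ (Y ^ k))).trace
        = ∑ i, ∑ j, X i j * (X * φ (Y ^ k)) j i := rfl
      _ = -∑ j, ∑ i, (X * φ (Y ^ k)) j i * X i j := by
        rw [Finset.sum_comm]
        simp only [hodd, Finset.sum_neg_distrib]
      _ = -(X * φ (Y ^ k) * X).trace := rfl
      _ = _ := by rw [hOX]
  have hzero : (X * (X * φ (Y ^ k))).trace = 0 := by
    have h2 : (2 : A) • (X * (X * φ (Y ^ k))).trace = 0 := by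
      rw [two_smul]; nth_rewrite 1 [hneg]; exact neg_add_cancel _
    have h3 : (algebraMap ℚ A 2⁻¹) * 2 = 1 := by
      rw [← map_ofNat (algebraMap ℚ A) 2, ← map_mul]; norm_num
    rw [← one_smul A (Matrix.trace _), ← h3, mul_smul, h2, smul_zero]
  refine Subtype.val_injective ?_
  have htr := AddMonoidHom.map_trace (Subalgebra.center A (ExteriorAlgebra A V)).val (Y ^ (k + 1))
  exact htr.trans ((congrArg Matrix.trace hpow).trans hzero)

/-- `Ω B Ω` as a matrix with entries in the centre of the exterior algebra, where the entries of `Ω`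
are the one-forms `v i j`. -/
def ExteriorAlgebra.sandwich {d A V : Type*} [Fintype d] [CommRing A]
    [AddCommGroup V] [Module A V] (B : Matrix d d A) (v : d → d → V) :
    Matrix d d (Subalgebra.center A (ExteriorAlgebra A V)) :=
  Matrix.of fun i j => ∑ a, ∑ b, B a b • ⟨ι A (v i a) * ι A (v b j), ι_mul_ι_mem_center _ _⟩

-- With `Z = sandwich B v`, the square of `BΩ` is `BZ`. Its `m`-th power is `± adj Z * adj B`, and
-- the last factor `BΩ` turns `adj B * B` into `det B`.
open ExteriorAlgebra in
theorem ExteriorAlgebra.mul_oneForms_pow {m : ℕ} {A V : Type*} [CommRing A] [Algebra ℚ A]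
    [AddCommGroup V] [Module A V] (B : Matrix (Fin (m + 1)) (Fin (m + 1)) A)
    (v : Fin (m + 1) → Fin (m + 1) → V) :
    (B.map (algebraMap A (ExteriorAlgebra A V)) * Matrix.of fun i j => ι A (v i j)) ^ (2 * m + 1) =
      ((-1) ^ m * B.det) • ((Subalgebra.center A (ExteriorAlgebra A V)).val.mapMatrix
        (sandwich B v).adjugate * Matrix.of fun i j => ι A (v i j)) := by
  let _ : Algebra ℚ (Subalgebra.center A (ExteriorAlgebra A V)) :=
    ((algebraMap A _).comp (algebraMap ℚ A)).toAlgebra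
  set φ := (Subalgebra.center A (ExteriorAlgebra A V)).val.mapMatrix (m := Fin (m + 1)) with hφ
  set Ω : Matrix (Fin (m + 1)) (Fin (m + 1)) (ExteriorAlgebra A V) :=
    Matrix.of fun i j => ι A (v i j) with hΩ
  set B' := B.map (algebraMap A (ExteriorAlgebra A V)) with hB'
  set C := B.map (algebraMap A (Subalgebra.center A (ExteriorAlgebra A V))) with hC
  have hφC : φ C = B' := rfl
  have hZ : φ (sandwich B v) = Ω * B' * Ω := by
    ext i j
    have h1 : φ (sandwich B v) i j = ∑ a, ∑ b, B a b • (ι A (v i a) * ι A (v b j)) := by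
      change (Subalgebra.center A (ExteriorAlgebra A V)).val (∑ a, ∑ b, B a b • _) = _
      simp only [map_sum, map_smul, Subalgebra.coe_val]
    rw [h1, Finset.sum_comm]
    simp only [Matrix.mul_apply, Finset.sum_mul, hΩ, hB', Matrix.of_apply, Matrix.map_apply]
    refine Finset.sum_congr rfl fun b _ => Finset.sum_congr rfl fun a _ => ?_
    rw [← Algebra.commutes, mul_assoc, ← Algebra.smul_def]
  have hX : B' * Ω = Matrix.of fun i j => ι A (∑ a, B i a • v a j) := by
    ext i j
    simp [hB', hΩ, Matrix.mul_apply, Algebra.smul_def]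
  have hY : φ (C * sandwich B v) = (B' * Ω) * (B' * Ω) := by
    rw [map_mul, hφC, hZ]; simp only [mul_assoc]
  have htr := ExteriorAlgebra.trace_pow_eq_zero (fun i j => ∑ a, B i a • v a j)
    (C * sandwich B v) (by rw [← hX, ← hY])
  have hchar := Matrix.charpoly_eq_X_pow_of_trace_pow_eq_zero _ htr
  rw [Fintype.card_fin] at hchar
  have hadj := Matrix.pow_eq_adjugate_of_charpoly_eq_X_pow _ hchar
  have hdet : φ C.adjugate * B' = (B.det • 1 : Matrix _ _ (ExteriorAlgebra A V)) := by
    rw [← hφC, ← map_mul, Matrix.adjugate_mul, hC, ← RingHom.mapMatrix_apply, ← RingHom.map_det,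
      algebraMap_smul, map_smul, map_one]
  rw [pow_succ, pow_mul, sq, ← hY, ← map_pow, hadj, Matrix.adjugate_mul_distrib]
  refine (congrArg (· * (B' * Ω)) (map_zsmul φ ((-1 : ℤ) ^ m) _)).trans ?_
  rw [map_mul, smul_mul_assoc, mul_assoc, ← mul_assoc _ B', hdet,
    smul_mul_assoc, one_mul, mul_smul_comm, mul_smul, ← Int.cast_smul_eq_zsmul A]
  simp

/-! ### Expansion of the adjugate times `Ω` into permanents. -/

namespace ExteriorAlgebra

variable {A V : Type*} [CommRing A] [AddCommGroup V] [Module A V]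

theorem ιMulti_mul_ι {m : ℕ} (u : Fin m → V) (w : V) :
    ιMulti A m u * ι A w = (-1 : A) ^ m • (ι A w * ιMulti A m u) := by
  induction m with
  | zero => simp
  | succ m ih =>
    have h : ι A (u 0) * ι A w = -(ι A w * ι A (u 0)) :=
      eq_neg_of_add_eq_zero_left (ι_add_mul_swap _ _)
    rw [ιMulti_succ_apply, mul_assoc, ih, mul_smul_comm, ← mul_assoc, h, pow_succ, mul_neg_one,
      neg_smul, neg_mul, smul_neg, mul_assoc]

theorem ιMulti_mul_ι_eq_insertNth {m : ℕ} (k : Fin (m + 1)) (u : Fin m → V) (w : V) :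
    ιMulti A m u * ι A w = (-1 : A) ^ (m + k : ℕ) • ιMulti A (m + 1) (k.insertNth w u) := by
  have h : ιMulti A (m + 1) (Matrix.vecCons w u) = ι A w * ιMulti A m u := by
    rw [ιMulti_succ_apply]; rfl
  rw [AlternatingMap.map_insertNth, ιMulti_mul_ι, h, pow_add, mul_smul,
    ← Int.cast_smul_eq_zsmul A, smul_smul ((-1) ^ (k : ℕ))]
  simp [← mul_pow]

/-- Each `v x` must pass every `u y` with `y > x`: one sign for each pair. -/
theorem prod_ι_mul_ι {m : ℕ} (u v : Fin m → V) :
    (List.ofFn fun x => ι A (u x) * ι A (v x)).prod =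
      (-1 : A) ^ m.choose 2 • (ιMulti A m u * ιMulti A m v) := by
  induction m with
  | zero => simp
  | succ m ih =>
    rw [List.ofFn_succ, List.prod_cons, ih, ιMulti_succ_apply, ιMulti_succ_apply,
      Nat.choose_succ_succ' m 1, Nat.choose_one_right, pow_add, mul_smul_comm, mul_comm (_ ^ m),
      mul_smul]
    congr 1
    have h := ιMulti_mul_ι (A := A) (fun x : Fin m => u x.succ) (v 0)
    have h' : ι A (v 0) * ιMulti A m (fun x : Fin m => u x.succ) =
        (-1 : A) ^ m • (ιMulti A m (fun x : Fin m => u x.succ) * ι A (v 0)) := by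
      rw [h, smul_smul, ← mul_pow]; simp
    change _ = (-1 : A) ^ m • (ι A (u 0) * ιMulti A m (fun x : Fin m => u x.succ) *
      (ι A (v 0) * ιMulti A m (fun x : Fin m => v x.succ)))
    calc _ = ι A (u 0) * (ι A (v 0) * ιMulti A m (fun x : Fin m => u x.succ)) *
          ιMulti A m (fun x : Fin m => v x.succ) := by simp only [mul_assoc]
      _ = _ := by rw [h']; simp only [mul_smul_comm, smul_mul_assoc, mul_assoc]

/-- The product of the one-forms in the positions `(r, a r)` followed by those in the positions
`(b x, j)`, where `j ≠ i` runs through the columns. -/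
noncomputable def rowColProd {m : ℕ} (v : Fin (m + 1) → Fin (m + 1) → V) (i : Fin (m + 1))
    (a : Fin (m + 1) → Fin (m + 1)) (b : Fin m → Fin (m + 1)) : ExteriorAlgebra A V :=
  ιMulti A (m + 1 + m) (Fin.append (fun r => v r (a r)) fun x => v (b x) (i.succAbove x))

/-- Separating the two families costs `m.choose 2` signs and sorting the second costs `sign σ`.
Moving the last factor past `m` forms and then into slot `k` of the first family costs `m + (m - k)`
signs, which has the parity of `k`. -/
theorem prod_mul_ι_eq_rowColProd {m : ℕ} (v : Fin (m + 1) → Fin (m + 1) → V) (i j k : Fin (m + 1))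
    (a b : Fin m → Fin (m + 1)) (σ : Equiv.Perm (Fin m)) :
    (List.ofFn fun x => ι A (v (k.succAbove x) (a x)) *
        ι A (v (b (σ x)) (i.succAbove (σ x)))).prod * ι A (v k j) =
      ((-1 : A) ^ (m.choose 2 + k : ℕ) * ((Equiv.Perm.sign σ : ℤ) : A)) •
        rowColProd v i (k.insertNth (α := fun _ => Fin (m + 1)) j a) b := by
  have h1 : (fun r => v r ((k.insertNth (α := fun _ => Fin (m + 1)) j a : Fin (m + 1) → _) r)) =
      k.insertNth (α := fun _ => V) (v k j) fun x => v (k.succAbove x) (a x) := by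
    refine (Fin.eq_insertNth_iff).mpr ⟨by simp, ?_⟩
    ext x; simp [Fin.removeNth]
  have h2 := (ιMulti A m).map_perm (fun x => v (b x) (i.succAbove x)) σ
  have h3 : ιMulti A m (fun x => v (b (σ x)) (i.succAbove (σ x))) =
      ((Equiv.Perm.sign σ : ℤ) : A) • ιMulti A m fun x => v (b x) (i.succAbove x) := by
    rw [Int.cast_smul_eq_zsmul, ← Units.smul_def]
    exact h2
  rw [prod_ι_mul_ι, rowColProd, ← ιMulti_mul_ιMulti, h1, smul_mul_assoc, mul_assoc, ιMulti_mul_ι,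
    mul_smul_comm, ← mul_assoc, ιMulti_mul_ι_eq_insertNth k, h3]
  simp only [smul_mul_assoc, mul_smul_comm, smul_smul]
  congr 1
  rw [pow_add, pow_add]
  have hm : ((-1 : A) ^ m) * (-1) ^ m = 1 := by rw [← mul_pow]; simp
  linear_combination ((-1 : A) ^ m.choose 2 * (-1) ^ (k : ℕ) * ((Equiv.Perm.sign σ : ℤ) : A)) * hm

/-- In the cofactor expansion, `sign σ` and `(-1) ^ k` each occur twice, once from the minor and
once from reordering one-forms. They cancel, and the determinant becomes a permanent. The ring `K`
serves to form the adjugate over a commutative ring. -/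
theorem adjugate_mul_ι {m : ℕ} {K : Type*} [CommRing K] [Algebra A K]
    (ψ : K →ₐ[A] ExteriorAlgebra A V) (B : Matrix (Fin (m + 1)) (Fin (m + 1)) A)
    (v : Fin (m + 1) → Fin (m + 1) → V) (c : Fin (m + 1) → Fin (m + 1) → Fin (m + 1) →
      Fin (m + 1) → K) (hc : ∀ i a b j, ψ (c i a b j) = ι A (v i a) * ι A (v b j))
    (i j : Fin (m + 1)) :
    ∑ k, ψ ((Matrix.of fun i j => ∑ a, ∑ b, B a b • c i a b j).adjugate i k) * ι A (v k j) =
      (-1 : A) ^ (m.choose 2 + i : ℕ) • ∑ a : Fin (m + 1) → Fin (m + 1), ∑ b : Fin m → Fin (m + 1),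
        (∑ k, if a k = j then
          BOmega.perm (Matrix.of fun x y => B (a (k.succAbove x)) (b y)) else 0) •
            rowColProd v i a b := by
  have hdet : ∀ k, ψ ((Matrix.of fun i j => ∑ a, ∑ b, B a b • c i a b j).adjugate i k) =
      (-1 : A) ^ (k + i : ℕ) • ∑ a : Fin m → Fin (m + 1), ∑ b : Fin m → Fin (m + 1),
        ∑ σ : Equiv.Perm (Fin m), (((Equiv.Perm.sign σ : ℤ) : A) * ∏ x, B (a x) (b (σ x))) •
          (List.ofFn fun x => ι A (v (k.succAbove x) (a x)) *
            ι A (v (b (σ x)) (i.succAbove (σ x)))).prod := by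
    intro k
    have hprod : ∀ σ : Equiv.Perm (Fin m),
        ψ (∏ x, ∑ a, ∑ b, B a b • c (k.succAbove x) a b (i.succAbove (σ x))) =
        ∑ a : Fin m → Fin (m + 1), ∑ b : Fin m → Fin (m + 1), (∏ x, B (a x) (b (σ x))) •
          (List.ofFn fun x => ι A (v (k.succAbove x) (a x)) *
            ι A (v (b (σ x)) (i.succAbove (σ x)))).prod := by
      intro σ
      simp only [Fintype.prod_sum, Finset.prod_smul, map_sum, map_smul]
      refine Finset.sum_congr rfl fun a _ => ?_
      -- Indexing `b` by the column `σ x` rather than the row `x` makes the sorted product of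
      -- one-forms independent of `σ`.
      refine (Fintype.sum_equiv (σ.arrowCongr (Equiv.refl _)).symm _ _ fun b => ?_).symm
      have h : ∀ f : Fin m → K, ψ (∏ x, f x) = (List.ofFn fun x => ψ (f x)).prod := fun f => by
        rw [← List.prod_ofFn, map_list_prod, List.map_ofFn]; rfl
      rw [h]
      simp only [hc]
      rfl
    rw [Matrix.adjugate_fin_succ_eq_det_submatrix, ← Matrix.det_transpose, Matrix.det_apply']
    simp only [Matrix.transpose_apply, Matrix.submatrix_apply, Matrix.of_apply, map_mul, map_sum,
      map_pow, map_neg, map_one, map_intCast, hprod]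
    rw [Algebra.smul_def, map_pow, map_neg, map_one]
    congr 1
    rw [Finset.sum_congr rfl fun σ _ => Finset.mul_sum _ _ _, Finset.sum_comm]
    refine Finset.sum_congr rfl fun a _ => ?_
    rw [Finset.sum_congr rfl fun σ _ => Finset.mul_sum _ _ _, Finset.sum_comm]
    refine Finset.sum_congr rfl fun b _ => Finset.sum_congr rfl fun σ _ => ?_
    rw [mul_smul, Int.cast_smul_eq_zsmul, zsmul_eq_mul]
  have hk : ∀ k, ψ ((Matrix.of fun i j => ∑ a, ∑ b, B a b • c i a b j).adjugate i k) *
      ι A (v k j) = (-1 : A) ^ (m.choose 2 + i : ℕ) •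
        ∑ a : Fin (m + 1) → Fin (m + 1), ∑ b : Fin m → Fin (m + 1), (if a k = j then
          BOmega.perm (Matrix.of fun x y => B (a (k.succAbove x)) (b y)) else 0) •
            rowColProd v i a b := by
    intro k
    -- A function on all rows splits into its value at `k` and its restriction to the other rows;
    -- only the value `j` contributes.
    rw [hdet, ← Equiv.sum_comp (Fin.insertNthEquiv (fun _ => Fin (m + 1)) k),
      Fintype.sum_prod_type, Finset.sum_eq_single j, smul_mul_assoc,
      Finset.sum_mul, Finset.smul_sum, Finset.smul_sum]
    · refine Finset.sum_congr rfl fun a _ => ?_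
      rw [Finset.smul_sum, Finset.sum_mul, Finset.smul_sum]
      refine Finset.sum_congr rfl fun b _ => ?_
      rw [Finset.sum_mul, Finset.smul_sum]
      simp only [smul_mul_assoc, prod_mul_ι_eq_rowColProd, Fin.insertNthEquiv_apply,
        Fin.insertNth_apply_same, Fin.insertNth_apply_succAbove, if_true, BOmega.perm,
        Finset.sum_smul, smul_smul, Finset.smul_sum, Matrix.of_apply]
      refine Finset.sum_congr rfl fun σ _ => ?_
      congr 1
      have hs : (((Equiv.Perm.sign σ : ℤ) : A)) * ((Equiv.Perm.sign σ : ℤ) : A) = 1 := by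
        rw [← Int.cast_mul, ← Units.val_mul, Int.units_mul_self]; simp
      have hk : ((-1 : A) ^ (k : ℕ)) * (-1) ^ (k : ℕ) = 1 := by rw [← mul_pow]; simp
      rw [pow_add, pow_add, pow_add]
      linear_combination (∏ x, B (a x) (b (σ x))) * (-1) ^ m.choose 2 * (-1) ^ (i : ℕ) *
        (((-1 : A) ^ (k : ℕ)) * (-1) ^ (k : ℕ) * hs + hk)
    · intro j' _ hj
      refine Finset.sum_eq_zero fun a _ => Finset.sum_eq_zero fun b _ => ?_
      simp [hj]
    · simp
  simp only [hk, ← Finset.smul_sum, Finset.sum_smul]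
  rw [Finset.sum_comm]
  congr 1
  refine Finset.sum_congr rfl fun a _ => ?_
  rw [Finset.sum_comm]

end ExteriorAlgebra

/-! ### The entries of `Φ_ν` as permanents, and independence of the deleted column. -/

namespace BOmega

theorem perm_submatrix_equiv {r c r' c' A : Type*} [Fintype r] [Fintype c] [DecidableEq r]
    [DecidableEq c] [Fintype r'] [Fintype c'] [DecidableEq r'] [DecidableEq c'] [CommSemiring A]
    (M : Matrix r c A) (e : r' ≃ r) (g : c' ≃ c) : perm (M.submatrix e g) = perm M := by
  refine Fintype.sum_equiv (e.equivCongr g) _ _ fun σ => ?_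
  refine Fintype.prod_equiv e _ _ fun i => ?_
  simp

/-- The copies of the values of `c` are in bijection with its arguments. -/
theorem exists_copies_equiv {n l : ℕ} (c : Fin l → Fin n) (p : Fin n → ℤ)
    (hp : ∀ i, p i = ((Finset.univ.filter fun x => c x = i).card : ℤ)) :
    ∃ e : Copies p ≃ Fin l, ∀ x, c (e x) = x.1 := by
  have h : ∀ i, Fintype.card (Fin (p i).toNat) = Fintype.card {x // c x = i} := fun i => by
    rw [Fintype.card_fin, hp, Fintype.card_subtype, Int.toNat_natCast]
  refine ⟨(Equiv.sigmaCongrRight fun i => Fintype.equivOfCardEq (h i)).trans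
    (Equiv.sigmaFiberEquiv c), fun x => ?_⟩
  exact (Fintype.equivOfCardEq (h x.1) x.2).2

theorem permPoly_eq_perm {n l : ℕ} {A : Type*} [CommRing A] (B : Matrix (Fin n) (Fin n) A)
    (c d : Fin l → Fin n) (p q : Fin n → ℤ)
    (hp : ∀ i, p i = ((Finset.univ.filter fun x => c x = i).card : ℤ))
    (hq : ∀ i, q i = ((Finset.univ.filter fun x => d x = i).card : ℤ)) :
    permPoly p q B = perm (Matrix.of fun x y => B (c x) (d y)) := by
  obtain ⟨e, he⟩ := exists_copies_equiv c p hp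
  obtain ⟨g, hg⟩ := exists_copies_equiv d q hq
  rw [permPoly, if_pos ⟨fun i => by simp [hp], fun i => by simp [hq]⟩,
    ← perm_submatrix_equiv _ e g]
  congr 1
  ext x y
  simp [he, hg]

/-- The weight hypotheses say that `ν` has one position in each row with columns `a`, and one in
each column other than `i` with rows `b`. Hence `q(ν)_j + δ_ij - 1` counts the `k` with `a k = j`.
For each such `k` the weights in the permanent are those of `a` without its `k`-th value and of `b`.
-/
theorem Phi_apply_eq_sum {m : ℕ} {A : Type*} [CommRing A] (ν : MType (m + 1))
    (B : Matrix (Fin (m + 1)) (Fin (m + 1)) A) (i j : Fin (m + 1))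
    (a : Fin (m + 1) → Fin (m + 1)) (b : Fin m → Fin (m + 1))
    (hcol : ∀ s, colWeight ν s = ∑ r, (if a r = s then 1 else 0) +
      ∑ x, if i.succAbove x = s then 1 else 0)
    (hrow : ∀ s, rowWeight ν s = ∑ r, (if r = s then 1 else 0) + ∑ x, if b x = s then 1 else 0) :
    Phi ν B i j = ∑ k, if a k = j then
      perm (Matrix.of fun x y => B (a (k.succAbove x)) (b y)) else 0 := by
  have hcol' : ∀ s, colWeight ν s = ∑ r, (if a r = s then 1 else 0) + 1 - if i = s then 1 else 0 := by
    intro s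
    have h : (∑ r : Fin (m + 1), if r = s then (1 : ℤ) else 0) = 1 := by simp
    rw [Fin.sum_univ_succAbove _ i] at h
    rw [hcol]
    linear_combination h
  have hperm : ∀ k, a k = j →
      permPoly (colWeight ν + Pi.single i 1 - Pi.single j 1 - 1) (rowWeight ν - 1) B =
        perm (Matrix.of fun x y => B (a (k.succAbove x)) (b y)) := by
    intro k hk
    refine permPoly_eq_perm B (fun x => a (k.succAbove x)) b _ _ (fun s => ?_) fun s => ?_
    · rw [Finset.card_filter]
      push_cast
      simp only [Pi.sub_apply, Pi.add_apply, Pi.one_apply, Pi.single_apply, hcol',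
        Fin.sum_univ_succAbove _ k, hk, eq_comm (a := s)]
      ring
    · rw [Finset.card_filter]
      push_cast
      simp [hrow]
  have hcoef : colWeight ν j + (if i = j then 1 else 0) - 1 = ∑ k, if a k = j then 1 else 0 := by
    rw [hcol']; ring
  rw [Phi, Matrix.of_apply, hcoef, Finset.sum_smul]
  refine Finset.sum_congr rfl fun k _ => ?_
  split_ifs with hk
  · rw [one_smul, hperm k hk]
  · rw [zero_smul]

theorem incidence_apply {n : ℕ} {ν : MType n} (e : ν.Ordering) (l : Fin (2 * n - 1))
    (c : Fin (2 * n - 1 + 1)) : incidence e l c =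
      (if (c : ℕ) = ((e l).1.1 : ℕ) then -1 else 0) +
        if (c : ℕ) = n + ((e l).1.2 : ℕ) then 1 else 0 := by
  have := (e l).1.1.2
  rw [incidence, Matrix.of_apply]
  split_ifs <;> omega

theorem sum_incidence {n : ℕ} {ν : MType n} (e : ν.Ordering) (l : Fin (2 * n - 1)) :
    ∑ c, incidence e l c = 0 := by
  have h1 := (e l).1.1.2
  have h2 := (e l).1.2.2
  simp only [incidence_apply, Finset.sum_add_distrib]
  rw [Finset.sum_eq_single (⟨(e l).1.1, by omega⟩ : Fin (2 * n - 1 + 1)),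
    Finset.sum_eq_single (⟨n + (e l).1.2, by omega⟩ : Fin (2 * n - 1 + 1))]
  · simp
  all_goals simp [Fin.ext_iff]

/-- The form `ω_ν` does not depend on the deleted column. -/
theorem omegaForm_eq {n : ℕ} {S : Type*} [Ring S] (Ω : Matrix (Fin n) (Fin n) S) {ν : MType n}
    (e : ν.Ordering) (k k' : Fin (2 * n - 1 + 1)) : omegaForm Ω e k = omegaForm Ω e k' := by
  rw [omegaForm, omegaForm]
  congr 1
  -- As the rows of `M_ν` sum to zero, changing the deleted column multiplies the minor by `(-1) ^
  -- (k - k')`, which the sign in `ω_ν` compensates.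
  have h := Matrix.submatrix_succAbove_det_eq_negOnePow_submatrix_succAbove_det' (incidence e)
    (sum_incidence e) k k'
  rw [incidenceMinor, h, incidenceMinor, Units.smul_def, smul_eq_mul, ← mul_assoc]
  congr 1
  rw [pow_add, pow_add, Int.negOnePow_sub, Units.val_mul, Int.negOnePow_def, Int.negOnePow_def,
    zpow_natCast, zpow_natCast]
  have hk : ((-1 : ℤ) ^ (k : ℕ)) * (-1) ^ (k : ℕ) = 1 := by rw [← mul_pow]; simp
  push_cast
  linear_combination ((-1 : ℤ) ^ n.choose 2 * (-1) ^ (k' : ℕ)) * hk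

end BOmega

/-! ### The forms `ω_ν` as sums over sequences of positions. -/

namespace BOmega

open ExteriorAlgebra

/-- The entry of `M_ν` in the row of the position `x` and in column `c`. -/
def incidenceEntry (n : ℕ) (x : Fin n × Fin n) (c : ℕ) : ℤ :=
  (if c = (x.1 : ℕ) then -1 else 0) + if c = n + (x.2 : ℕ) then 1 else 0

/-- The positions `(r, a r)` for all rows `r`, followed by the positions `(b x, j)` for the columns
`j ≠ i`. -/
def rowColPositions {m : ℕ} (i : Fin (m + 1)) (a : Fin (m + 1) → Fin (m + 1))
    (b : Fin m → Fin (m + 1)) : Fin (m + 1 + m) → Fin (m + 1) × Fin (m + 1) :=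
  Fin.append (fun r => (r, a r)) fun x => (b x, i.succAbove x)

theorem rowColPositions_injective {m : ℕ} (i : Fin (m + 1)) :
    Function.Injective fun p : (Fin (m + 1) → Fin (m + 1)) × (Fin m → Fin (m + 1)) =>
      rowColPositions i p.1 p.2 := by
  rintro ⟨a, b⟩ ⟨a', b'⟩ h
  refine Prod.ext (funext fun r => ?_) (funext fun x => ?_)
  · simpa [rowColPositions] using congrFun h (Fin.castAdd m r)
  · simpa [rowColPositions] using congrFun h (Fin.natAdd (m + 1) x)

/-- Once column `m + 1 + i` of `M_ν` is deleted, the first `m + 1` columns left belong to the rows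
of `Ω`, the other `m` to its columns except `i`. -/
theorem succAbove_castAdd {m : ℕ} (i : Fin (m + 1)) (k : Fin (m + 1 + m + 1))
    (hk : (k : ℕ) = m + 1 + i) (r : Fin (m + 1)) : (k.succAbove (Fin.castAdd m r) : ℕ) = r := by
  have := r.2
  rw [Fin.succAbove_of_castSucc_lt _ _ (by simp [Fin.lt_def, hk]; omega)]
  simp

theorem succAbove_natAdd {m : ℕ} (i : Fin (m + 1)) (k : Fin (m + 1 + m + 1))
    (hk : (k : ℕ) = m + 1 + i) (x : Fin m) :
    (k.succAbove (Fin.natAdd (m + 1) x) : ℕ) = m + 1 + i.succAbove x := by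
  simp only [Fin.succAbove, Fin.lt_def, hk, Fin.val_castSucc, Fin.val_natAdd]
  split_ifs <;> simp <;> omega

theorem prod_incidenceEntry_rowColPositions {m : ℕ} (i : Fin (m + 1)) (k : Fin (m + 1 + m + 1))
    (hk : (k : ℕ) = m + 1 + i) (a : Fin (m + 1) → Fin (m + 1)) (b : Fin m → Fin (m + 1)) :
    ∏ l, incidenceEntry (m + 1) (rowColPositions i a b l) (k.succAbove l) = (-1) ^ (m + 1) := by
  have h1 : ∀ r : Fin (m + 1), incidenceEntry (m + 1) (r, a r) r = -1 := fun r => by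
    have := r.2
    rw [incidenceEntry, if_pos rfl, if_neg (by simp only; omega), add_zero]
  have h2 : ∀ x : Fin m, incidenceEntry (m + 1) (b x, i.succAbove x) (m + 1 + i.succAbove x) = 1 :=
    fun x => by
      have := (b x).2
      rw [incidenceEntry, if_pos rfl, if_neg (by simp only; omega), zero_add]
  simp [Fin.prod_univ_add, succAbove_castAdd i k hk, succAbove_natAdd i k hk, rowColPositions, h1,
    h2]

/-- A nonzero factor forces the position matched with a row of `Ω` to lie in that row, and likewise
for columns. -/
theorem mem_range_of_prod_incidenceEntry_ne_zero {m : ℕ} (i : Fin (m + 1))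
    (k : Fin (m + 1 + m + 1)) (hk : (k : ℕ) = m + 1 + i)
    (f : Fin (m + 1 + m) → Fin (m + 1) × Fin (m + 1))
    (hf : ∏ l, incidenceEntry (m + 1) (f l) (k.succAbove l) ≠ 0) :
    f ∈ Set.range fun p : (Fin (m + 1) → Fin (m + 1)) × (Fin m → Fin (m + 1)) =>
      rowColPositions i p.1 p.2 := by
  rw [Finset.prod_ne_zero_iff] at hf
  refine ⟨⟨fun r => (f (Fin.castAdd m r)).2, fun x => (f (Fin.natAdd (m + 1) x)).1⟩,
    funext fun l => ?_⟩
  induction l using Fin.addCases with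
  | left r =>
    have h := hf (Fin.castAdd m r) (Finset.mem_univ _)
    rw [succAbove_castAdd i k hk, incidenceEntry] at h
    have hr : (r : ℕ) = (f (Fin.castAdd m r)).1 := by
      have := r.2
      by_contra hne
      rw [if_neg hne, if_neg (by omega)] at h
      exact h rfl
    simp only [rowColPositions, Fin.append_left]
    exact Prod.ext (Fin.ext hr) rfl
  | right x =>
    have h := hf (Fin.natAdd (m + 1) x) (Finset.mem_univ _)
    rw [succAbove_natAdd i k hk, incidenceEntry] at h
    have hr : (i.succAbove x : ℕ) = (f (Fin.natAdd (m + 1) x)).2 := by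
      have := (f (Fin.natAdd (m + 1) x)).1.2
      by_contra hne
      rw [if_neg (by omega), if_neg (by omega)] at h
      exact h rfl
    simp only [rowColPositions, Fin.append_right]
    exact Prod.ext rfl (Fin.ext hr)

/-- `ω_ν` as a sum over all orderings of `ν`. -/
theorem omegaForm_eq_sum {n : ℕ} {A V : Type*} [CommRing A] [AddCommGroup V] [Module A V]
    (v : Fin n → Fin n → V) {ν : MType n} (e : ν.Ordering) (k : Fin (2 * n - 1 + 1)) :
    omegaForm (Matrix.of fun i j => ι A (v i j)) e k =
      (-1 : A) ^ (n.choose 2 + k : ℕ) • ∑ σ : Equiv.Perm (Fin (2 * n - 1)),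
        ((∏ l, incidenceEntry n (e (σ l)).1 (k.succAbove l) : ℤ) : A) •
          ιMulti A (2 * n - 1) fun l => v (e (σ l)).1.1 (e (σ l)).1.2 := by
  have h : ∀ σ : Equiv.Perm (Fin (2 * n - 1)),
      (ιMulti A (2 * n - 1) fun l => v (e (σ l)).1.1 (e (σ l)).1.2) =
        ((Equiv.Perm.sign σ : ℤ) : A) • eta (Matrix.of fun i j => ι A (v i j)) e := fun σ => by
    rw [Int.cast_smul_eq_zsmul, ← Units.smul_def]
    exact (ιMulti A (2 * n - 1)).map_perm (fun l => v (e l).1.1 (e l).1.2) σ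
  rw [omegaForm, incidenceMinor, Matrix.det_apply, ← Int.cast_smul_eq_zsmul A]
  simp only [h, smul_smul, ← Finset.sum_smul]
  congr 1
  push_cast
  congr 1
  refine Finset.sum_congr rfl fun σ _ => ?_
  rw [Units.smul_def, smul_eq_mul]
  push_cast
  rw [mul_comm]
  congr 1
  refine Finset.prod_congr rfl fun l _ => ?_
  simp [Matrix.submatrix_apply, incidence_apply, incidenceEntry]

/-- The set of values of an injective sequence of positions, as a type. -/
def MType.ofInjective {n : ℕ} (f : Fin (2 * n - 1) → Fin n × Fin n) (hf : Function.Injective f) :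
    MType n :=
  ⟨Finset.univ.image f, by rw [Finset.card_image_of_injective _ hf, Finset.card_fin]⟩

theorem ofInjective_ordering {n : ℕ} {ν : MType n} (e : ν.Ordering)
    (σ : Equiv.Perm (Fin (2 * n - 1))) (h : Function.Injective fun l => (e (σ l)).1) :
    MType.ofInjective (fun l => (e (σ l)).1) h = ν := by
  refine Subtype.ext (Finset.ext fun x => ?_)
  simp only [MType.ofInjective, Finset.mem_image, Finset.mem_univ, true_and]
  exact ⟨fun ⟨l, hl⟩ => hl ▸ (e (σ l)).2, fun hx => ⟨σ.symm (e.symm ⟨x, hx⟩), by simp⟩⟩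

/-- An injective sequence of positions is an ordering of exactly one type, its image. -/
theorem sum_types_eq_sum_functions {n : ℕ} {M : Type*} [AddCommMonoid M]
    (e : ∀ ν : MType n, ν.Ordering) (F : MType n → (Fin (2 * n - 1) → Fin n × Fin n) → M) :
    ∑ ν, ∑ σ : Equiv.Perm (Fin (2 * n - 1)), F ν (fun l => (e ν (σ l)).1) =
      ∑ f : Fin (2 * n - 1) → Fin n × Fin n,
        open Classical in if hf : Function.Injective f then F (MType.ofInjective f hf) f else 0 := by
  classical
  rw [← Fintype.sum_prod_type']
  have hinj : ∀ p : MType n × Equiv.Perm (Fin (2 * n - 1)),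
      Function.Injective fun l => (e p.1 (p.2 l)).1 := fun p =>
    Subtype.val_injective.comp ((e p.1).injective.comp p.2.injective)
  refine Fintype.sum_of_injective (fun p => fun l => (e p.1 (p.2 l)).1) ?_ _ _ ?_ ?_
  · rintro ⟨ν, σ⟩ ⟨ν', σ'⟩ h
    obtain rfl : ν = ν' := by
      rw [← ofInjective_ordering (e ν) σ (hinj (ν, σ)),
        ← ofInjective_ordering (e ν') σ' (hinj (ν', σ'))]
      congr 1
    congr 1
    ext1 l
    exact (e ν).injective (Subtype.ext (congrFun h l))
  · intro f hf
    rw [dif_neg]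
    intro hinjf
    refine hf ⟨(MType.ofInjective f hinjf, (Equiv.ofBijective (fun l => (⟨f l, by
      simp [MType.ofInjective]⟩ : {x // x ∈ (MType.ofInjective f hinjf).1})) ⟨fun l l' h =>
        hinjf (congrArg Subtype.val h), fun x => ?_⟩).trans (e _).symm), ?_⟩
    · obtain ⟨l, -, hl⟩ := Finset.mem_image.mp x.2
      exact ⟨l, Subtype.ext hl⟩
    · ext1 l
      exact congrArg Subtype.val ((e _).apply_symm_apply _)
  · rintro ⟨ν, σ⟩
    rw [dif_pos (hinj (ν, σ)), ofInjective_ordering]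

end BOmega

/-! ### Comparison of the two expansions in the exterior algebra. -/

namespace BOmega

open ExteriorAlgebra

/-- Only the sequences `rowColPositions i a b` contribute. The length is a variable `N` so that `hN`
can be substituted. -/
theorem sum_functions_eq_sum_rowColProd {m N : ℕ} {A V : Type*} [CommRing A] [AddCommGroup V]
    [Module A V] (v : Fin (m + 1) → Fin (m + 1) → V) (hN : N = m + 1 + m) (i : Fin (m + 1))
    (k : Fin (N + 1)) (hk : (k : ℕ) = m + 1 + i)
    (G : (Fin N → Fin (m + 1) × Fin (m + 1)) → A) :
    ∑ f : Fin N → Fin (m + 1) × Fin (m + 1),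
        ((∏ l, incidenceEntry (m + 1) (f l) (k.succAbove l) : ℤ) : A) •
          G f • ιMulti A N (fun l => v (f l).1 (f l).2) =
      (-1 : A) ^ (m + 1) • ∑ a : Fin (m + 1) → Fin (m + 1), ∑ b : Fin m → Fin (m + 1),
        G (fun l => rowColPositions i a b (Fin.cast hN l)) • rowColProd v i a b := by
  subst hN
  rw [← Fintype.sum_prod_type', Finset.smul_sum]
  symm
  refine Fintype.sum_of_injective _ (rowColPositions_injective i) _ _ (fun f hf => ?_) fun p => ?_
  · have h : ∏ l, incidenceEntry (m + 1) (f l) (k.succAbove l) = 0 := by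
      by_contra h
      exact hf (mem_range_of_prod_incidenceEntry_ne_zero i k hk f h)
    rw [h, Int.cast_zero, zero_smul]
  · rw [prod_incidenceEntry_rowColPositions i k hk, rowColProd]
    push_cast
    congr 3
    ext l
    induction l using Fin.addCases <;> simp [rowColPositions]

theorem sum_fin_cast {m N : ℕ} (hN : N = m + 1 + m) (g : Fin (m + 1 + m) → ℤ) :
    ∑ l : Fin N, g (Fin.cast hN l) =
      ∑ r, g (Fin.castAdd m r) + ∑ x, g (Fin.natAdd (m + 1) x) := by
  subst hN
  exact Fin.sum_univ_add g

theorem rowWeight_ofInjective {n : ℕ} (f : Fin (2 * n - 1) → Fin n × Fin n)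
    (hf : Function.Injective f) (s : Fin n) :
    rowWeight (MType.ofInjective f hf) s = ∑ l, if (f l).1 = s then 1 else 0 := by
  rw [rowWeight, MType.ofInjective, Finset.card_filter, Finset.sum_image fun x _ y _ h => hf h]
  push_cast
  rfl

theorem colWeight_ofInjective {n : ℕ} (f : Fin (2 * n - 1) → Fin n × Fin n)
    (hf : Function.Injective f) (s : Fin n) :
    colWeight (MType.ofInjective f hf) s = ∑ l, if (f l).2 = s then 1 else 0 := by
  rw [colWeight, MType.ofInjective, Finset.card_filter, Finset.sum_image fun x _ y _ h => hf h]
  push_cast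
  rfl

theorem sum_Phi_smul_omegaForm {m : ℕ} {A V : Type*} [CommRing A] [AddCommGroup V] [Module A V]
    (B : Matrix (Fin (m + 1)) (Fin (m + 1)) A) (v : Fin (m + 1) → Fin (m + 1) → V)
    (e : ∀ ν : MType (m + 1), ν.Ordering) (k : MType (m + 1) → Fin (2 * (m + 1) - 1 + 1))
    (i j : Fin (m + 1)) :
    ∑ ν, Phi ν B i j • omegaForm (Matrix.of fun i j => ι A (v i j)) (e ν) (k ν) =
      (-1 : A) ^ (m.choose 2 + m + i : ℕ) •
        ∑ a : Fin (m + 1) → Fin (m + 1), ∑ b : Fin m → Fin (m + 1),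
        (∑ k, if a k = j then
          perm (Matrix.of fun x y => B (a (k.succAbove x)) (b y)) else 0) •
            rowColProd v i a b := by
  classical
  have hN : 2 * (m + 1) - 1 = m + 1 + m := by omega
  have hi := i.2
  -- `ω_ν` does not depend on the deleted column, so the column may be chosen according to the row
  -- `i` of the entry being computed.
  set k₀ : Fin (2 * (m + 1) - 1 + 1) := ⟨m + 1 + i, by omega⟩ with hk₀
  have h1 : ∀ ν, Phi ν B i j • omegaForm (Matrix.of fun i j => ι A (v i j)) (e ν) (k ν) =
      (-1 : A) ^ ((m + 1).choose 2 + k₀ : ℕ) • ∑ σ : Equiv.Perm (Fin (2 * (m + 1) - 1)),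
        ((∏ l, incidenceEntry (m + 1) (e ν (σ l)).1 (k₀.succAbove l) : ℤ) : A) • Phi ν B i j •
          ιMulti A (2 * (m + 1) - 1) fun l => v (e ν (σ l)).1.1 (e ν (σ l)).1.2 := by
    intro ν
    rw [omegaForm_eq _ _ _ k₀, omegaForm_eq_sum, smul_comm, Finset.smul_sum]
    simp only [smul_comm (Phi ν B i j)]
  have h2 := sum_types_eq_sum_functions e fun ν f =>
    ((∏ l, incidenceEntry (m + 1) (f l) (k₀.succAbove l) : ℤ) : A) • Phi ν B i j •
      ιMulti A (2 * (m + 1) - 1) fun l => v (f l).1 (f l).2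
  have h3 := sum_functions_eq_sum_rowColProd v hN i k₀ rfl fun f =>
    if hf : Function.Injective f then Phi (MType.ofInjective f hf) B i j else 0
  have h4 : ∀ a : Fin (m + 1) → Fin (m + 1), ∀ b : Fin m → Fin (m + 1),
      (if hf : Function.Injective fun l => rowColPositions i a b (Fin.cast hN l) then
        Phi (MType.ofInjective _ hf) B i j else 0) • rowColProd (A := A) v i a b =
      (∑ k, if a k = j then
          perm (Matrix.of fun x y => B (a (k.succAbove x)) (b y)) else 0) •
            rowColProd v i a b := by
    intro a b
    split_ifs with hf
    · rw [Phi_apply_eq_sum _ B i j a b]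
      · intro s
        rw [colWeight_ofInjective, sum_fin_cast hN fun l =>
          if (rowColPositions i a b l).2 = s then 1 else 0]
        simp [rowColPositions]
      · intro s
        rw [rowWeight_ofInjective, sum_fin_cast hN fun l =>
          if (rowColPositions i a b l).1 = s then 1 else 0]
        simp [rowColPositions]
    -- A sequence that repeats a position defines no type, but its product of one-forms vanishes.
    · have h : rowColProd (A := A) v i a b = 0 := by
        refine ιMulti_eq_zero_of_not_inj fun hinj => hf fun l l' hl => ?_
        refine Fin.cast_injective hN (hinj ?_)
        have hw : ∀ l, Fin.append (fun r => v r (a r)) (fun x => v (b x) (i.succAbove x)) l =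
            v (rowColPositions i a b l).1 (rowColPositions i a b l).2 := fun l => by
          induction l using Fin.addCases <;> simp [rowColPositions]
        rw [hw, hw]
        simp only at hl
        rw [hl]
      rw [h, smul_zero, smul_zero]
  rw [Finset.sum_congr rfl fun ν _ => h1 ν, ← Finset.smul_sum, h2]
  have h5 : ∀ f : Fin (2 * (m + 1) - 1) → Fin (m + 1) × Fin (m + 1),
      (if hf : Function.Injective f then
        ((∏ l, incidenceEntry (m + 1) (f l) (k₀.succAbove l) : ℤ) : A) •
          Phi (MType.ofInjective f hf) B i j •
            ιMulti A (2 * (m + 1) - 1) (fun l => v (f l).1 (f l).2) else 0) =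
      ((∏ l, incidenceEntry (m + 1) (f l) (k₀.succAbove l) : ℤ) : A) •
        (if hf : Function.Injective f then Phi (MType.ofInjective f hf) B i j else 0) •
          ιMulti A (2 * (m + 1) - 1) (fun l => v (f l).1 (f l).2) := fun f => by
    split_ifs <;> simp
  rw [Finset.sum_congr rfl fun f _ => h5 f, h3]
  simp only [h4]
  rw [smul_smul, Nat.choose_succ_succ' m 1, Nat.choose_one_right, hk₀]
  congr 1
  have hs : ((-1 : A) ^ (m + 1)) * (-1) ^ (m + 1) = 1 := by rw [← mul_pow]; simp
  simp only [pow_add] at hs ⊢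
  linear_combination ((-1 : A) ^ m * (-1) ^ m.choose 2 * (-1) ^ (i : ℕ)) * hs

/-- The formula for matrices of one-forms in an exterior algebra. -/
theorem XPow_ι {m : ℕ} {A V : Type*} [CommRing A] [Algebra ℚ A] [AddCommGroup V] [Module A V]
    (B : Matrix (Fin (m + 1)) (Fin (m + 1)) A) (v : Fin (m + 1) → Fin (m + 1) → V)
    (e : ∀ ν : MType (m + 1), ν.Ordering) (k : MType (m + 1) → Fin (2 * (m + 1) - 1 + 1)) :
    XPow B (Matrix.of fun i j => ι A (v i j)) = B.det • ∑ ν : MType (m + 1),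
      (Phi ν B).map fun a => a • omegaForm (Matrix.of fun i j => ι A (v i j)) (e ν) (k ν) := by
  refine Matrix.ext fun i j => ?_
  have h := adjugate_mul_ι (Subalgebra.center A (ExteriorAlgebra A V)).val B v
    (fun i a b j => ⟨ι A (v i a) * ι A (v b j), ι_mul_ι_mem_center _ _⟩)
    (fun _ _ _ _ => rfl) i j
  rw [Matrix.smul_apply, Matrix.sum_apply]
  simp only [Matrix.map_apply]
  rw [sum_Phi_smul_omegaForm]
  have h2 : XPow B (Matrix.of fun i j => ι A (v i j)) = _ := mul_oneForms_pow B v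
  rw [h2, Matrix.smul_apply, Matrix.mul_apply]
  refine (congrArg (((-1) ^ m * B.det) • ·) h).trans ?_
  rw [smul_smul, smul_smul]
  congr 1
  simp only [pow_add]
  ring

/-! ### Transfer to anticommuting entries, and restriction to a single type. -/

/-- The square of a linear combination of the `w x` equals its own negative, hence is zero as `2` is
invertible; the universal property of the exterior algebra applies. -/
theorem exists_algHom_of_anticommute {ι' A S : Type*} [Fintype ι'] [DecidableEq ι'] [CommRing A]
    [Algebra ℚ A] [Ring S] [Algebra A S] (w : ι' → S) (hw : ∀ x y, w x * w y = -(w y * w x)) :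
    ∃ ψ : ExteriorAlgebra A (ι' → A) →ₐ[A] S, ∀ x, ψ (ι A (Pi.single x 1)) = w x := by
  have hsq : ∀ v, Fintype.linearCombination A w v * Fintype.linearCombination A w v = 0 := by
    intro v
    set T := Fintype.linearCombination A w v * Fintype.linearCombination A w v with hT
    have hneg : T = -T := by
      rw [hT, Fintype.linearCombination_apply, Finset.sum_mul_sum]
      nth_rewrite 1 [Finset.sum_comm]
      simp only [← Finset.sum_neg_distrib]
      refine Finset.sum_congr rfl fun x _ => Finset.sum_congr rfl fun y _ => ?_
      rw [smul_mul_smul_comm, smul_mul_smul_comm, hw y x, smul_neg, mul_comm (v x)]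
    have h2 : (2 : A) • T = 0 := by
      rw [two_smul]; nth_rewrite 1 [hneg]; exact neg_add_cancel _
    have h3 : (algebraMap ℚ A 2⁻¹) * 2 = 1 := by
      rw [← map_ofNat (algebraMap ℚ A) 2, ← map_mul]; norm_num
    rw [← one_smul A T, ← h3, mul_smul, h2, smul_zero]
  refine ⟨ExteriorAlgebra.lift A ⟨Fintype.linearCombination A w, hsq⟩, fun x => ?_⟩
  rw [ExteriorAlgebra.lift_ι_apply, Fintype.linearCombination_apply_single, one_smul]

theorem map_omegaForm {n : ℕ} {S T : Type*} [Ring S] [Ring T] (ψ : S →+* T)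
    (Ω : Matrix (Fin n) (Fin n) S) {ν : MType n} (e : ν.Ordering) (k : Fin (2 * n - 1 + 1)) :
    ψ (omegaForm Ω e k) = omegaForm (Ω.map ψ) e k := by
  rw [omegaForm, omegaForm, map_zsmul, eta, eta, map_list_prod, List.map_ofFn]
  rfl

/-- The formula for matrices of `0`-forms and of pairwise anticommuting `1`-forms. -/
theorem XPow_eq {n : ℕ} (hn : 1 ≤ n) {A S : Type*} [CommRing A] [Algebra ℚ A] [Ring S]
    [Algebra A S] (B : Matrix (Fin n) (Fin n) A) (Ω : Matrix (Fin n) (Fin n) S)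
    (hΩ : ∀ i j k l, Ω i j * Ω k l = -(Ω k l * Ω i j))
    (e : ∀ ν : MType n, ν.Ordering) (k : MType n → Fin (2 * n - 1 + 1)) :
    XPow B Ω = B.det • ∑ ν : MType n, (Phi ν B).map fun a => a • omegaForm Ω (e ν) (k ν) := by
  obtain ⟨m, rfl⟩ : ∃ m, n = m + 1 := ⟨n - 1, by omega⟩
  obtain ⟨ψ, hψ⟩ := exists_algHom_of_anticommute (A := A)
    (fun x : Fin (m + 1) × Fin (m + 1) => Ω x.1 x.2) fun x y => hΩ _ _ _ _
  set Ω' : Matrix (Fin (m + 1)) (Fin (m + 1))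
    (ExteriorAlgebra A (Fin (m + 1) × Fin (m + 1) → A)) :=
    Matrix.of fun i j => ι A (Pi.single (i, j) 1) with hΩ'
  have hmap : ψ.mapMatrix Ω' = Ω := by
    ext i j
    exact hψ (i, j)
  have hB : ψ.mapMatrix (B.map (algebraMap A _)) = B.map (algebraMap A S) := by
    ext i j
    simp
  have h := congrArg ψ.mapMatrix (XPow_ι B (fun i j => Pi.single (i, j) 1) e k)
  rw [← hΩ', XPow, map_pow, map_mul, hB, hmap] at h
  rw [XPow, h, map_smul, map_sum]
  congr 1
  refine Finset.sum_congr rfl fun ν _ => Matrix.ext fun i j => ?_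
  have ho := map_omegaForm (ψ : _ →+* S) Ω' (e ν) (k ν)
  have hmap' : Ω'.map (ψ : _ →+* S) = Ω := hmap
  rw [hmap'] at ho
  simp only [AlgHom.mapMatrix_apply, Matrix.map_apply, map_smul]
  exact congrArg _ ho

/-- All types have the same size, so `ν'` contains a position outside `ν`. -/
theorem eta_restrict_of_ne {n : ℕ} {S : Type*} [Ring S] (Ω : Matrix (Fin n) (Fin n) S)
    {ν ν' : MType n} (h : ν' ≠ ν) (e : ν'.Ordering) : eta (restrict Ω ν) e = 0 := by
  have hsub : ¬ ν'.1 ⊆ ν.1 := fun hs =>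
    h (Subtype.ext (Finset.eq_of_subset_of_card_le hs (by rw [ν.2, ν'.2])))
  obtain ⟨x, hx, hx'⟩ := Finset.not_subset.mp hsub
  refine List.prod_eq_zero ((List.mem_ofFn' _ _).mpr ⟨e.symm ⟨x, hx⟩, ?_⟩)
  simp [restrict, hx']

theorem omegaForm_restrict_self {n : ℕ} {S : Type*} [Ring S] (Ω : Matrix (Fin n) (Fin n) S)
    {ν : MType n} (e : ν.Ordering) (k : Fin (2 * n - 1 + 1)) :
    omegaForm (restrict Ω ν) e k = omegaForm Ω e k := by
  have h : ∀ l, restrict Ω ν (e l).1.1 (e l).1.2 = Ω (e l).1.1 (e l).1.2 := fun l => by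
    rw [restrict, Matrix.of_apply, if_pos (e l).2]
  simp only [omegaForm, eta, h]

/-- The formula for a single type. -/
theorem XPow_restrict {n : ℕ} (hn : 1 ≤ n) {A S : Type*} [CommRing A] [Algebra ℚ A] [Ring S]
    [Algebra A S] (B : Matrix (Fin n) (Fin n) A) (Ω : Matrix (Fin n) (Fin n) S)
    (hΩ : ∀ i j k l, Ω i j * Ω k l = -(Ω k l * Ω i j)) (ν : MType n) (e : ν.Ordering)
    (k : Fin (2 * n - 1 + 1)) :
    XPow B (restrict Ω ν) = B.det • (Phi ν B).map fun a => a • omegaForm Ω e k := by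
  classical
  have hord : ∀ ν' : MType n, Nonempty ν'.Ordering := fun ν' =>
    ⟨Fintype.equivOfCardEq (by rw [Fintype.card_fin, Fintype.card_coe, ν'.2])⟩
  have hr : ∀ i j k l, restrict Ω ν i j * restrict Ω ν k l =
      -(restrict Ω ν k l * restrict Ω ν i j) := by
    intro i j k l
    simp only [restrict, Matrix.of_apply]
    split_ifs <;> simp [hΩ i j k l]
  -- The general formula needs an ordering of every type. Only the one at `ν` matters, and the
  -- update makes it `e`.
  have h := XPow_eq hn B (restrict Ω ν) hr
    (Function.update (fun ν' => (hord ν').some) ν e) fun _ => k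
  rw [h, Finset.sum_eq_single ν, Function.update_self, omegaForm_restrict_self]
  · intro ν' _ hne
    refine Matrix.ext fun i j => ?_
    rw [Matrix.map_apply, omegaForm, eta_restrict_of_ne _ hne, smul_zero, smul_zero]
    rfl
  · simp

theorem genOmega_anticommute {n : ℕ} (i j k l : Fin n) :
    genOmega n i j * genOmega n k l = -(genOmega n k l * genOmega n i j) :=
  eq_neg_of_add_eq_zero_left (ι_add_mul_swap _ _)

end BOmega

theorem mainTheorem8 (n : ℕ) (hn : 1 ≤ n) :
    -- generic matrices, one type at a time
    (∀ (ν : BOmega.MType n) (e : ν.Ordering) (k : Fin (2 * n - 1 + 1)),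
      BOmega.XPow (BOmega.genB n) (BOmega.restrict (BOmega.genOmega n) ν) =
        (BOmega.genB n).det •
          (BOmega.Phi ν (BOmega.genB n)).map
            (fun a => a • BOmega.omegaForm (BOmega.genOmega n) e k)) ∧
    -- generic matrices, sum over all types
    (∀ (e : ∀ ν : BOmega.MType n, ν.Ordering) (k : BOmega.MType n → Fin (2 * n - 1 + 1)),
      BOmega.XPow (BOmega.genB n) (BOmega.genOmega n) =
          ∑ ν : BOmega.MType n,
            BOmega.XPow (BOmega.genB n) (BOmega.restrict (BOmega.genOmega n) ν) ∧
      BOmega.XPow (BOmega.genB n) (BOmega.genOmega n) =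
        (BOmega.genB n).det •
          ∑ ν : BOmega.MType n,
            (BOmega.Phi ν (BOmega.genB n)).map
              (fun a => a • BOmega.omegaForm (BOmega.genOmega n) (e ν) (k ν))) ∧
    -- arbitrary matrices of 0-forms and of 1-forms
    (∀ (A S : Type*) [CommRing A] [Algebra ℚ A] [Ring S] [Algebra A S]
      (B : Matrix (Fin n) (Fin n) A) (Ω : Matrix (Fin n) (Fin n) S),
      (∀ i j k l, Ω i j * Ω k l = -(Ω k l * Ω i j)) →
      ∀ (e : ∀ ν : BOmega.MType n, ν.Ordering) (k : BOmega.MType n → Fin (2 * n - 1 + 1)),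
        BOmega.XPow B Ω =
          B.det •
            ∑ ν : BOmega.MType n,
              (BOmega.Phi ν B).map (fun a => a • BOmega.omegaForm Ω (e ν) (k ν))) := by
  have hgen := fun ν e k => BOmega.XPow_restrict hn (BOmega.genB n) (BOmega.genOmega n)
    BOmega.genOmega_anticommute ν e k
  refine ⟨hgen, fun e k => ?_, fun A S _ _ _ _ B Ω hΩ e k => BOmega.XPow_eq hn B Ω hΩ e k⟩
  have h := BOmega.XPow_eq hn (BOmega.genB n) (BOmega.genOmega n) BOmega.genOmega_anticommute e k
  refine ⟨?_, h⟩
  rw [h, Finset.smul_sum]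
  exact Finset.sum_congr rfl fun ν _ => (hgen ν (e ν) (k ν)).symm
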